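/- Let $\mathbb{N}=\{1,2,\dots\}$ and let $\mathcal{U}$ be the set of finite words over $\mathbb{N}$, with $|u|$ the length of $u$. A tree is a finite set $\mathbf{t}\subset\mathcal{U}$ containing the empty word and such that $ui\in\mathbf{t}$ (with $u \in \mathcal U$, $i \in \mathbb N$) implies $u\in\mathbf{t}$ and $uj\in\mathbf{t}$ for $1\le j\le i$. Let $c_{\mathbf{t}}(u)$ be the number of children $ui\in\mathbf{t}$ of $u\in\mathbf{t}$. If the root has type $i\in\{0,1\}$, the vertex $u$ has type $i+|u| \bmod 2$, and $\mathbf{t}^{(j)}$ denotes the set of vertices of type $j$. Let $\mu_0,\mu_1$ be probability distributions on $\{0,1,2,\dots\}$ with means $m_0,m_1$. Assume that they are nondegenerate, $\mu_0(1)+\mu_1(1)<2$, critical, $m_0m_1=1$, and that they admit small exponential moments: for each $k\in\{0,1\}$ there is $a>0$ with $\sum_{r\ge 0}\mu_k(r)e^{ar}<\infty$. For $i\in\{0,1\}$ let $P^{(i)}$ be the law of the alternating two-type Galton–Watson tree $T$ with root of type $i$, that is, $$P^{(i)}(T=\mathbf{t})=\prod_{u\in\mathbf{t}^{(0)}}\mu_0(c_{\mathbf{t}}(u))\prod_{u\in\mathbf{t}^{(1)}}\mu_1(c_{\mathbf{t}}(u)).$$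 For a tree $\mathbf{t}$ whose vertices in depth-first (lexicographical) order are $u(0)\prec u(1)\prec\dots\prec u(\#\mathbf{t}-1)$, and for $c\in\{0,1\}$, let $J^{(c)}_{\mathbf{t}}(k)=\#\big(\mathbf{t}^{(c)}\cap\{u(0),\dots,u(k)\}\big)$ and $$\bar J^{(c)}_{\mathbf{t}}(s)=\frac{J^{(c)}_{\mathbf{t}}(\lfloor(\#\mathbf{t}-1)s\rfloor)}{\#\mathbf{t}^{(c)}},\qquad 0\le s\le 1.$$ Then for all $i,j\in\{0,1\}$, under $P^{(i)}(\,\cdot\mid\#T^{(j)}=n)$, the processes $(\bar J_T^{(c)}(s),0\le s\le1)$, $c\in\{0,1\}$, converge in probability to the identity for the uniform norm: for every $c\in\{0,1\}$ and $\varepsilon>0$, $$P^{(i)}\Big(\sup_{0\le s\le 1}\big|\bar J_T^{(c)}(s)-s\big|>\varepsilon\;\Big|\;\#T^{(j)}=n\Big)\longrightarrow 0,$$ as $n\to\infty$ along the values for which $P^{(i)}(\#T^{(j)}=n)>0$. -/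

import Mathlib

open MeasureTheory ProbabilityTheory Filter Topology
open scoped ENNReal

namespace TwoTypeGW

/-- Finite words over the alphabet `{1, 2, 3, …}`. The order `≤` on words is the lexicographic
one, in which a word comes after each of its prefixes: this is the depth-first order. -/
abbrev Word : Type := List ℕ+

/-- A (rooted, planar) tree: a finite set of words that contains the empty word and such that
`u i ∈ t` implies `u ∈ t` and `u j ∈ t` for all `1 ≤ j ≤ i`. -/
@[ext]
structure PlanarTree where
  /-- the set of vertices -/
  verts : Finset Word
  root_mem : [] ∈ verts
  closed : ∀ (u : Word) (i : ℕ+), u ++ [i] ∈ verts →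
    u ∈ verts ∧ ∀ j : ℕ+, j ≤ i → u ++ [j] ∈ verts

/-- The set of trees is countable, and every set of trees is an event. -/
instance : MeasurableSpace PlanarTree := ⊤

namespace PlanarTree

/-- The number `#t` of vertices. -/
def size (t : PlanarTree) : ℕ := t.verts.card

open Classical in
/-- The number `c_t(u)` of children of the vertex `u` in `t`. -/
noncomputable def children (t : PlanarTree) (u : Word) : ℕ :=
  (t.verts.filter fun v => ∃ i : ℕ+, v = u ++ [i]).card

/-- The set `t^(j)` of vertices of type `j`, when the root of `t` has type `i` and the types
alternate between generations: the vertex `u` has type `i + |u|` modulo 2. -/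
def ofType (t : PlanarTree) (i j : ZMod 2) : Finset Word :=
  t.verts.filter fun u => i + (u.length : ZMod 2) = j

/-- The list `u(0) ≺ u(1) ≺ … ≺ u(#t - 1)` of the vertices of `t` in depth-first order. -/
def depthFirst (t : PlanarTree) : List Word := t.verts.sort (· ≤ ·)

/-- `J_t^(c)(k)`, the number of vertices of type `c` among `u(0), …, u(k)`, when the root of `t`
has type `i`. -/
def countUpTo (t : PlanarTree) (i c : ZMod 2) (k : ℕ) : ℕ :=
  (t.ofType i c ∩ (t.depthFirst.take (k + 1)).toFinset).card

/-- The normalized counting process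
`s ↦ J_t^(c)(⌊(#t - 1) s⌋) / #t^(c)`, for `0 ≤ s ≤ 1`. -/
noncomputable def normalizedCount (t : PlanarTree) (i c : ZMod 2) (s : ℝ) : ℝ :=
  (t.countUpTo i c ⌊((t.size : ℝ) - 1) * s⌋₊ : ℝ) / ((t.ofType i c).card : ℝ)

/-- The uniform distance on `[0, 1]` between the normalized counting process of type `c` and the
identity. -/
noncomputable def distToIdentity (t : PlanarTree) (i c : ZMod 2) : ℝ :=
  ⨆ s : Set.Icc (0 : ℝ) 1, |t.normalizedCount i c s - s|

end PlanarTree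

/-- The mean of a probability distribution on `{0, 1, 2, …}`. -/
noncomputable def mean (ν : PMF ℕ) : ℝ≥0∞ := ∑' k : ℕ, (k : ℝ≥0∞) * ν k

/-- The pair of offspring distributions is nondegenerate. -/
def Nondegenerate (μ : ZMod 2 → PMF ℕ) : Prop := μ 0 1 + μ 1 1 < 2

/-- The pair of offspring distributions is critical. -/
def Critical (μ : ZMod 2 → PMF ℕ) : Prop := mean (μ 0) * mean (μ 1) = 1

/-- The distribution `ν` admits small exponential moments. -/
def HasSmallExpMoments (ν : PMF ℕ) : Prop :=
  ∃ a : ℝ, 0 < a ∧ ∑' k : ℕ, ν k * ENNReal.ofReal (Real.exp (a * k)) < ∞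

/-- The probability `∏_{u ∈ t} μ_{type of u}(c_t(u))` that the two-type Galton-Watson tree
with root of type `i` equals `t`. -/
noncomputable def gwWeight (μ : ZMod 2 → PMF ℕ) (i : ZMod 2) (t : PlanarTree) : ℝ≥0∞ :=
  ∏ u ∈ t.verts, μ (i + (u.length : ZMod 2)) (t.children u)

/-- The law `P^(i)` of the alternating two-type Galton-Watson tree with offspring
distributions `μ 0`, `μ 1` and with root of type `i`. -/
noncomputable def gwLaw (μ : ZMod 2 → PMF ℕ) (i : ZMod 2) : Measure PlanarTree :=
  Measure.sum fun t => gwWeight μ i t • Measure.dirac t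

/-- The event `#T^(j) = n` for a tree `T` with root of type `i`. -/
def typeCountEvent (i j : ZMod 2) (n : ℕ) : Set PlanarTree :=
  {t | (t.ofType i j).card = n}

end TwoTypeGW

/-! The estimate compares an exponentially small bad event with a conditioning event that is not
exponentially rare.

A tree is encoded by its child counts in depth-first order. In a prefix of the exploration, every
vertex of type `τ + 1` other than the root is a child of a visited vertex of type `τ`, so there are
at most `1 + ∑ c` of them, the sum running over the visited vertices of type `τ`. An exponential
supermartingale shows that `∑ (c - m τ - κ)` ever exceeds `κ n` with probability at most `exp (-θ κ
n)` (`total_exceeds_le`). Off these events, for both types, each type is at most about `m τ` times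
as frequent as the other. Since `m 0 * m 1 = 1`, the two upper bounds force both frequencies in
every prefix, up to `O(κ #T)` (`abs_count_sub_le`, `PlanarTree.distToIdentity_le`).

For the conditioning event, criticality makes the generating function of `#T^(j)` infinite beyond
`1` (`genFun_eq_top`), so some tree size `m` has probability above `C ρ^(2m)`, however close `ρ < 1`
is to `1`. Grafting trees of that size repeatedly carries the bound to every large size in the
support (`exists_graft`, `exists_mul_pow_le_sizeProb`). -/

namespace TwoTypeGW

/-! ### Forests as words of child counts, and integration over these words. -/

/-- Exploration with a stack: the top `a` of the stack is removed, a letter `c` is read, and the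
list `next a c` is put on the stack. The result is the list of the removed elements. -/
def explore {α : Type*} (next : α → ℕ → List α) : List α → List ℕ → List α
  | [], _ => []
  | _ :: _, [] => []
  | a :: st, c :: w => a :: explore next (next a c ++ st) w

/-- The types, in depth-first order, of the vertices of the forest with child counts `w` and with
roots of types `st`. -/
def typeSeq : List (ZMod 2) → List ℕ → List (ZMod 2) :=
  explore fun τ c => List.replicate c (τ + 1)

@[simp] lemma typeSeq_nil (w : List ℕ) : typeSeq [] w = [] := by
  simp [typeSeq, explore]

@[simp] lemma typeSeq_cons_nil (τ : ZMod 2) (st : List (ZMod 2)) : typeSeq (τ :: st) [] = [] := by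
  simp [typeSeq, explore]

@[simp] lemma typeSeq_cons_cons (τ : ZMod 2) (st : List (ZMod 2)) (c : ℕ) (w : List ℕ) :
    typeSeq (τ :: st) (c :: w) = τ :: typeSeq (List.replicate c (τ + 1) ++ st) w := by
  simp [typeSeq, explore]

/-- The probability that the forest with roots of types `st` has the child counts `w` in
depth-first order. -/
noncomputable def weight (μ : ZMod 2 → PMF ℕ) : List (ZMod 2) → List ℕ → ℝ≥0∞
  | [], [] => 1
  | [], _ :: _ => 0
  | _ :: _, [] => 0
  | τ :: st, c :: w => μ τ c * weight μ (List.replicate c (τ + 1) ++ st) w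

/-- The integral of `F` against the law of the word of child counts of a forest. -/
noncomputable def total (μ : ZMod 2 → PMF ℕ) (st : List (ZMod 2)) (F : List ℕ → ℝ≥0∞) : ℝ≥0∞ :=
  ∑' w, weight μ st w * F w

lemma tsum_list_nat (f : List ℕ → ℝ≥0∞) : ∑' w, f w = f [] + ∑' c, ∑' w, f (c :: w) := by
  rw [ENNReal.tsum_eq_add_tsum_ite []]
  congr 1
  rw [← ENNReal.tsum_prod (f := fun c w => f (c :: w))]
  have hinj : Function.Injective fun p : ℕ × List ℕ => p.1 :: p.2 := by
    rintro ⟨a, b⟩ ⟨c, d⟩ h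
    simpa using h
  rw [← hinj.tsum_eq]
  · simp
  · intro w hw
    cases w with
    | nil => simp at hw
    | cons c w => exact ⟨(c, w), rfl⟩

variable {μ : ZMod 2 → PMF ℕ}

@[simp] lemma total_nil (F : List ℕ → ℝ≥0∞) : total μ [] F = F [] := by
  rw [total, tsum_list_nat]
  simp [weight]

lemma total_cons (τ : ZMod 2) (st : List (ZMod 2)) (F : List ℕ → ℝ≥0∞) :
    total μ (τ :: st) F =
      ∑' c, μ τ c * total μ (List.replicate c (τ + 1) ++ st) fun w => F (c :: w) := by
  rw [total, tsum_list_nat]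
  simp [total, weight, mul_assoc, ENNReal.tsum_mul_left]

lemma total_mono (st : List (ZMod 2)) {F G : List ℕ → ℝ≥0∞} (h : ∀ w, F w ≤ G w) :
    total μ st F ≤ total μ st G :=
  ENNReal.tsum_le_tsum fun w => mul_le_mul_right (h w) _

/-- The integral over words of length at most `l`. -/
noncomputable def truncTotal (μ : ZMod 2 → PMF ℕ) (l : ℕ) (st : List (ZMod 2))
    (F : List ℕ → ℝ≥0∞) : ℝ≥0∞ :=
  total μ st fun w => if w.length ≤ l then F w else 0

@[simp] lemma truncTotal_nil (l : ℕ) (F : List ℕ → ℝ≥0∞) : truncTotal μ l [] F = F [] := by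
  simp [truncTotal]

@[simp] lemma truncTotal_zero_cons (τ : ZMod 2) (st : List (ZMod 2)) (F : List ℕ → ℝ≥0∞) :
    truncTotal μ 0 (τ :: st) F = 0 := by
  rw [truncTotal, total, tsum_list_nat]
  simp [weight]

lemma truncTotal_succ_cons (l : ℕ) (τ : ZMod 2) (st : List (ZMod 2)) (F : List ℕ → ℝ≥0∞) :
    truncTotal μ (l + 1) (τ :: st) F =
      ∑' c, μ τ c * truncTotal μ l (List.replicate c (τ + 1) ++ st) fun w => F (c :: w) := by
  simp [truncTotal, total_cons]

/-- A sum of nonnegative terms is the supremum of its finite partial sums, each of which involves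
words of bounded length. Upper bounds can thus be proved by induction on the length, whereas the
recursion of `total_cons` does not terminate. -/
lemma total_le_of_truncTotal_le {st : List (ZMod 2)} {F : List ℕ → ℝ≥0∞} {B : ℝ≥0∞}
    (h : ∀ l, truncTotal μ l st F ≤ B) : total μ st F ≤ B := by
  unfold total
  rw [ENNReal.tsum_eq_iSup_sum]
  refine iSup_le fun s => le_trans ?_ (h (s.sup List.length))
  unfold truncTotal total
  refine le_trans (le_of_eq ?_) (ENNReal.sum_le_tsum s)
  refine Finset.sum_congr rfl fun w hw => ?_
  have := Finset.le_sup (f := List.length) hw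
  simp [this]

lemma total_one_le (st : List (ZMod 2)) : total μ st (fun _ => 1) ≤ 1 := by
  refine total_le_of_truncTotal_le fun l => ?_
  induction l generalizing st with
  | zero => cases st <;> simp
  | succ l ih =>
    cases st with
    | nil => simp
    | cons τ st =>
      rw [truncTotal_succ_cons]
      calc _ ≤ ∑' c, μ τ c * 1 := ENNReal.tsum_le_tsum fun c => mul_le_mul_right (ih _) _
        _ = 1 := by simp [PMF.tsum_coe]

lemma total_le_of_le_one (st : List (ZMod 2)) {F : List ℕ → ℝ≥0∞} (h : ∀ w, F w ≤ 1) :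
    total μ st F ≤ 1 :=
  (total_mono st h).trans (total_one_le st)

/-- Independence of the two parts of a forest. -/
lemma total_mul_le (st st' : List (ZMod 2)) (F : List ℕ → ℝ≥0∞) :
    (total μ st fun w => total μ st' fun w' => F (w ++ w')) ≤ total μ (st ++ st') F := by
  refine total_le_of_truncTotal_le fun l => ?_
  induction l generalizing st F with
  | zero => cases st <;> simp
  | succ l ih =>
    cases st with
    | nil => simp
    | cons τ st =>
      rw [truncTotal_succ_cons, List.cons_append, total_cons]
      refine ENNReal.tsum_le_tsum fun c => mul_le_mul_right ?_ _
      rw [← List.append_assoc]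
      exact ih _ fun w => F (c :: w)

/-- A word of nonzero weight empties its stack exactly when its last letter is read, so what follows
explores `st'` alone. -/
lemma typeSeq_append {st : List (ZMod 2)} {w : List ℕ} (h : weight μ st w ≠ 0)
    (st' : List (ZMod 2)) (w' : List ℕ) :
    typeSeq (st ++ st') (w ++ w') = typeSeq st w ++ typeSeq st' w' := by
  induction w generalizing st with
  | nil => cases st <;> simp_all [weight]
  | cons c w ih =>
    cases st with
    | nil => simp [weight] at h
    | cons τ st =>
      simp only [weight] at h
      simp [← ih (right_ne_zero_of_mul h)]

/-! ### Running sums of child counts and their exponential tails. -/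

/-- The running sum of `c - a` over the letters `c` that are read at type `τ` gets above `x`. -/
def Exceeds (τ : ZMod 2) (a : ℝ) : ℝ → List (ZMod 2) → List ℕ → Prop
  | x, [], _ => x < 0
  | x, _ :: _, [] => x < 0
  | x, σ :: st, c :: w =>
    x < 0 ∨ Exceeds τ a (if σ = τ then x - (c - a) else x) (List.replicate c (σ + 1) ++ st) w

lemma not_neg_of_not_exceeds {τ : ZMod 2} {a x : ℝ} {st : List (ZMod 2)} {w : List ℕ}
    (h : ¬ Exceeds τ a x st w) : 0 ≤ x := by
  cases st <;> cases w <;> simp_all [Exceeds]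

lemma zmod_two_ne_iff (σ τ : ZMod 2) : σ ≠ τ ↔ σ = τ + 1 := by
  revert σ τ; decide

lemma zmod_two_add_one_add_one (τ : ZMod 2) : τ + 1 + 1 = τ := by
  revert τ; decide

lemma zmod_two_ne_add_one (τ : ZMod 2) : τ ≠ τ + 1 := by
  revert τ; decide

/-- A visited vertex of type `τ + 1` was on the initial stack or is a child of a visited vertex of
type `τ`; the number of such children is at most `a` per parent, plus the level `x`. -/
lemma count_take_le_of_not_exceeds {τ : ZMod 2} {a x : ℝ} {st : List (ZMod 2)} {w : List ℕ}
    (h : ¬ Exceeds τ a x st w) (k : ℕ) :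
    ((((typeSeq st w).take k).count (τ + 1) : ℕ) : ℝ) ≤
      a * (((typeSeq st w).take k).count τ : ℕ) + x + (st.count (τ + 1) : ℕ) := by
  have hx := not_neg_of_not_exceeds h
  induction w generalizing st x k with
  | nil => cases st <;> simp <;> positivity
  | cons c w ih =>
    cases st with
    | nil => simpa
    | cons σ st =>
      cases k with
      | zero =>
        simp only [List.take_zero, List.count_nil, Nat.cast_zero, mul_zero, zero_add]
        positivity
      | succ k =>
        simp only [Exceeds, not_or] at h
        have := ih h.2 k (not_neg_of_not_exceeds h.2)
        by_cases hσ : σ = τ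
        · subst hσ
          simp only [if_true, List.count_append, List.count_replicate] at this
          simp at this ⊢
          linarith
        · rw [if_neg hσ] at this
          rw [← ne_eq, zmod_two_ne_iff] at hσ
          subst hσ
          simp only [zmod_two_add_one_add_one, List.count_append, List.count_replicate] at this
          simp [(zmod_two_ne_add_one τ).symm, zmod_two_add_one_add_one] at this ⊢
          linarith

open Classical in
/-- The maximal inequality for the exponential supermartingale of the running sum. -/
lemma total_exceeds_le {τ : ZMod 2} {a θ : ℝ} (hθ : 0 ≤ θ)
    (h : ∑' k : ℕ, μ τ k * ENNReal.ofReal (Real.exp (θ * k)) ≤ ENNReal.ofReal (Real.exp (θ * a)))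
    (x : ℝ) (st : List (ZMod 2)) :
    (total μ st fun w => if Exceeds τ a x st w then 1 else 0) ≤
      ENNReal.ofReal (Real.exp (-(θ * x))) := by
  refine total_le_of_truncTotal_le fun l => ?_
  induction l generalizing st x with
  | zero =>
    cases st with
    | nil =>
      simp only [truncTotal_nil, Exceeds]
      split_ifs with hx
      · rw [ENNReal.one_le_ofReal, Real.one_le_exp_iff]; nlinarith
      · simp
    | cons => simp
  | succ l ih =>
    by_cases hx : x < 0
    · calc _ ≤ (1 : ℝ≥0∞) := total_le_of_le_one _ fun w => by dsimp only; split_ifs <;> simp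
        _ ≤ _ := by rw [ENNReal.one_le_ofReal, Real.one_le_exp_iff]; nlinarith
    cases st with
    | nil => simp [Exceeds, hx]
    | cons σ st =>
      rw [truncTotal_succ_cons]
      simp only [Exceeds, hx, false_or]
      -- At type `τ` the level becomes `x - (c - a)`, and `h` says that `exp (θ (c - a))` has mean
      -- at most `1`; at the other type the level is unchanged.
      by_cases hσ : σ = τ
      · subst hσ
        simp only [if_true]
        calc _ ≤ ∑' c : ℕ, μ σ c * ENNReal.ofReal (Real.exp (-(θ * (x - (c - a))))) :=
              ENNReal.tsum_le_tsum fun c => mul_le_mul_right (ih _ _) _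
          _ = ∑' c : ℕ, ENNReal.ofReal (Real.exp (-(θ * x) - θ * a)) *
                (μ σ c * ENNReal.ofReal (Real.exp (θ * c))) := by
              refine tsum_congr fun c => ?_
              rw [mul_left_comm, ← ENNReal.ofReal_mul (Real.exp_nonneg _), ← Real.exp_add]
              ring_nf
          _ ≤ ENNReal.ofReal (Real.exp (-(θ * x) - θ * a)) *
                ENNReal.ofReal (Real.exp (θ * a)) := by
              rw [ENNReal.tsum_mul_left]; exact mul_le_mul_right h _
          _ = _ := by
              rw [← ENNReal.ofReal_mul (Real.exp_nonneg _), ← Real.exp_add]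
              ring_nf
      · simp only [hσ, if_false]
        calc _ ≤ ∑' c : ℕ, μ σ c * ENNReal.ofReal (Real.exp (-(θ * x))) :=
              ENNReal.tsum_le_tsum fun c => mul_le_mul_right (ih _ _) _
          _ = _ := by rw [ENNReal.tsum_mul_right, PMF.tsum_coe, one_mul]

lemma natCast_le_exp {a : ℝ} (ha : 0 < a) (k : ℕ) : (k : ℝ) ≤ 1 / a * Real.exp (a * k) := by
  have h := Real.add_one_le_exp (a * k)
  rw [one_div, ← div_eq_inv_mul, le_div_iff₀ ha]
  linarith

lemma HasSmallExpMoments.mean_ne_top {ν : PMF ℕ} (h : HasSmallExpMoments ν) : mean ν ≠ ∞ := by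
  obtain ⟨a, ha, h⟩ := h
  refine ne_top_of_le_ne_top (ENNReal.mul_ne_top (ENNReal.ofReal_ne_top (r := 1 / a)) h.ne) ?_
  rw [← ENNReal.tsum_mul_left]
  refine ENNReal.tsum_le_tsum fun k => ?_
  rw [mul_comm, mul_left_comm, ← ENNReal.ofReal_mul (by positivity)]
  refine mul_le_mul_right ?_ _
  rw [← ENNReal.ofReal_natCast]
  exact ENNReal.ofReal_le_ofReal (natCast_le_exp ha k)

lemma exp_le_one_add_add_sq_mul_exp {y : ℝ} (hy : 0 ≤ y) :
    Real.exp y ≤ 1 + y + y ^ 2 * Real.exp y := by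
  have h1 : Real.exp y - 1 ≤ y * Real.exp y := by
    have h := Real.add_one_le_exp (-y)
    have h2 : Real.exp (-y) * Real.exp y = 1 := by rw [← Real.exp_add]; simp
    nlinarith [Real.exp_pos y]
  nlinarith

/-- Near `0` the moment generating function is bounded by that of a Dirac mass slightly above the
mean. -/
lemma HasSmallExpMoments.exists_tsum_exp_le {ν : PMF ℕ} (h : HasSmallExpMoments ν) {κ : ℝ}
    (hκ : 0 < κ) : ∃ θ : ℝ, 0 < θ ∧ ∑' k : ℕ, ν k * ENNReal.ofReal (Real.exp (θ * k)) ≤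
      ENNReal.ofReal (Real.exp (θ * ((mean ν).toReal + κ))) := by
  have hm := h.mean_ne_top
  obtain ⟨a, ha, h⟩ := h
  set Φ := ∑' k : ℕ, ν k * ENNReal.ofReal (Real.exp (a * k)) with hΦ
  -- The bounds `k² ≤ (8 / a²) exp (a k / 2)` and `exp (θ k) ≤ exp (a k / 2)` make the second-order
  -- term at most `θ² K`, which `θ K ≤ κ` absorbs into `θ κ`.
  set K : ℝ := 8 / a ^ 2 * Φ.toReal with hK
  have hK0 : 0 ≤ K := by positivity
  obtain ⟨θ, hθ, hθa, hθK⟩ : ∃ θ : ℝ, 0 < θ ∧ θ ≤ a / 2 ∧ θ * K ≤ κ := by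
    refine ⟨min (a / 2) (κ / (K + 1)), by positivity, min_le_left _ _, ?_⟩
    calc _ ≤ κ / (K + 1) * K := by gcongr; exact min_le_right _ _
      _ ≤ κ / (K + 1) * (K + 1) := by gcongr; linarith
      _ = κ := by field_simp
  refine ⟨θ, hθ, ?_⟩
  have hpt (k : ℕ) : Real.exp (θ * k) ≤ 1 + θ * k + θ ^ 2 * (8 / a ^ 2) * Real.exp (a * k) := by
    refine (exp_le_one_add_add_sq_mul_exp (by positivity)).trans ?_
    have h1 : Real.exp (θ * k) ≤ Real.exp (a / 2 * k) := Real.exp_le_exp.2 (by gcongr)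
    have h2 : (k : ℝ) ^ 2 ≤ 8 / a ^ 2 * Real.exp (a / 2 * k) := by
      have := Real.quadratic_le_exp_of_nonneg (x := a / 2 * k) (by positivity)
      rw [div_mul_eq_mul_div, le_div_iff₀ (by positivity)]
      have : 0 ≤ a / 2 * k := by positivity
      nlinarith
    have h3 : Real.exp (a * k) = Real.exp (a / 2 * k) * Real.exp (a / 2 * k) := by
      rw [← Real.exp_add]; ring_nf
    have h4 : (θ * k) ^ 2 * Real.exp (θ * k) ≤ θ ^ 2 * (8 / a ^ 2) * Real.exp (a * k) := by
      calc _ = θ ^ 2 * ((k : ℝ) ^ 2 * Real.exp (θ * k)) := by ring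
        _ ≤ θ ^ 2 * (8 / a ^ 2 * Real.exp (a / 2 * k) * Real.exp (a / 2 * k)) := by gcongr
        _ = _ := by rw [h3]; ring
    linarith
  calc _ ≤ ∑' k : ℕ, (ν k + ENNReal.ofReal θ * (k * ν k) +
        ENNReal.ofReal (θ ^ 2 * (8 / a ^ 2)) * (ν k * ENNReal.ofReal (Real.exp (a * k)))) := by
        refine ENNReal.tsum_le_tsum fun k => ?_
        refine (mul_le_mul_right (ENNReal.ofReal_le_ofReal (hpt k)) _).trans (le_of_eq ?_)
        rw [ENNReal.ofReal_add (by positivity) (by positivity),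
          ENNReal.ofReal_add (by positivity) (by positivity), ENNReal.ofReal_mul hθ.le,
          ENNReal.ofReal_mul (p := θ ^ 2 * (8 / a ^ 2)) (by positivity), ENNReal.ofReal_one,
          ENNReal.ofReal_natCast]
        ring
    _ = 1 + ENNReal.ofReal θ * mean ν + ENNReal.ofReal (θ ^ 2 * (8 / a ^ 2)) * Φ := by
        rw [ENNReal.tsum_add, ENNReal.tsum_add, PMF.tsum_coe, ENNReal.tsum_mul_left,
          ENNReal.tsum_mul_left, mean]
    _ = ENNReal.ofReal (1 + θ * (mean ν).toReal + θ * (θ * K)) := by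
        have e1 : θ * (θ * K) = θ ^ 2 * (8 / a ^ 2) * Φ.toReal := by rw [hK]; ring
        rw [e1, ENNReal.ofReal_add (by positivity) (by positivity),
          ENNReal.ofReal_add (by positivity) (by positivity), ENNReal.ofReal_mul hθ.le,
          ENNReal.ofReal_mul (p := θ ^ 2 * (8 / a ^ 2)) (by positivity), ENNReal.ofReal_one,
          ENNReal.ofReal_toReal hm, ENNReal.ofReal_toReal h.ne]
    _ ≤ _ := by
        refine ENNReal.ofReal_le_ofReal ?_
        have := Real.add_one_le_exp (θ * ((mean ν).toReal + κ))
        nlinarith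


/-! ### The law of the number of vertices of type `j`: support and grafting. -/

/-- The probability that a forest with roots of types `st` has `n` vertices of type `j`. -/
noncomputable def sizeProb (μ : ZMod 2 → PMF ℕ) (j : ZMod 2) (st : List (ZMod 2)) (n : ℕ) :
    ℝ≥0∞ :=
  total μ st fun w => if (typeSeq st w).count j = n then 1 else 0

lemma sizeProb_le_one (j : ZMod 2) (st : List (ZMod 2)) (n : ℕ) : sizeProb μ j st n ≤ 1 :=
  total_le_of_le_one _ fun w => by split_ifs <;> simp

lemma sizeProb_nil (j : ZMod 2) (n : ℕ) : sizeProb μ j [] n = if n = 0 then 1 else 0 := by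
  simp [sizeProb, eq_comm]

lemma mul_sizeProb_le_sizeProb_cons (j τ : ZMod 2) (st : List (ZMod 2)) (c n : ℕ) :
    μ τ c * sizeProb μ j (List.replicate c (τ + 1) ++ st) n ≤
      sizeProb μ j (τ :: st) (n + if τ = j then 1 else 0) := by
  rw [sizeProb, sizeProb, total_cons]
  refine le_trans (mul_le_mul_right (total_mono _ fun w => ?_) _) (ENNReal.le_tsum c)
  rw [typeSeq_cons_cons, List.count_cons]
  by_cases h : τ = j <;> simp [h]

lemma sizeProb_mul_le (j : ZMod 2) (st st' : List (ZMod 2)) (a b : ℕ) :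
    sizeProb μ j st a * sizeProb μ j st' b ≤ sizeProb μ j (st ++ st') (a + b) := by
  refine le_trans ?_ (total_mul_le _ _ _)
  rw [sizeProb, total, ← ENNReal.tsum_mul_right]
  refine ENNReal.tsum_le_tsum fun w => ?_
  by_cases hw : weight μ st w = 0
  · simp [hw]
  rw [mul_assoc]
  refine mul_le_mul_right ?_ _
  split_ifs with ha
  · rw [one_mul]
    refine total_mono _ fun w' => ?_
    rw [typeSeq_append hw, List.count_append, ha]
    simp
  · simp

lemma sizeProb_singleton_eq_tsum {i j : ZMod 2} (h : i ≠ j) (n : ℕ) :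
    sizeProb μ j [i] n = ∑' k, μ i k * sizeProb μ j (List.replicate k j) n := by
  rw [sizeProb, total_cons]
  rw [zmod_two_ne_iff] at h
  subst h
  simp [zmod_two_add_one_add_one, sizeProb, (zmod_two_ne_add_one j).symm]

section Support

lemma mul_mean_eq_one (hcrit : Critical μ) (τ : ZMod 2) : mean (μ τ) * mean (μ (τ + 1)) = 1 := by
  fin_cases τ
  · exact hcrit
  · exact (mul_comm _ _).trans hcrit

lemma exists_pos_offspring (hcrit : Critical μ) (τ : ZMod 2) : ∃ k, 1 ≤ k ∧ μ τ k ≠ 0 := by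
  by_contra! h
  have h0 : mean (μ τ) = 0 := by
    rw [mean, ENNReal.tsum_eq_zero]
    rintro (_ | k)
    · simp
    · rw [h (k + 1) (by simp), mul_zero]
  simpa [h0] using mul_mean_eq_one hcrit τ

/-- Otherwise each mean is `μ τ 1 ≤ 1`; as their product is `1`, both equal `1`, which is the
degenerate case. -/
lemma exists_two_le_offspring (hnd : Nondegenerate μ) (hcrit : Critical μ) :
    ∃ τ k, 2 ≤ k ∧ μ τ k ≠ 0 := by
  by_contra! h
  have hm (τ : ZMod 2) : mean (μ τ) = μ τ 1 := by
    rw [mean, tsum_eq_single 1]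
    · simp
    · rintro k hk
      rcases k with _ | _ | k
      · simp
      · simp at hk
      · rw [h τ (k + 2) (by simp), mul_zero]
  have h1 (τ : ZMod 2) : 1 ≤ μ τ 1 := by
    rw [← mul_mean_eq_one hcrit τ, hm, hm]
    exact mul_le_of_le_one_right' ((μ (τ + 1)).coe_le_one 1)
  refine absurd hnd (not_lt.2 ?_)
  rw [← one_add_one_eq_two]
  exact add_le_add (h1 0) (h1 1)

/-- Otherwise both means are at least `1`, hence equal to `1`, which leaves no mass on the integers
`k ≥ 2`. -/
lemma exists_zero_offspring (hnd : Nondegenerate μ) (hcrit : Critical μ) : ∃ τ, μ τ 0 ≠ 0 := by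
  by_contra! h
  have hm (τ : ZMod 2) : mean (μ τ) = 1 + ∑' k : ℕ, ((k - 1 : ℕ) : ℝ≥0∞) * μ τ k := by
    rw [← (μ τ).tsum_coe, ← ENNReal.tsum_add, mean]
    refine tsum_congr fun k => ?_
    rcases k with _ | k
    · simp [h]
    · simp [add_mul, add_comm]
  have h1 (τ : ZMod 2) : mean (μ τ) ≤ 1 := by
    rw [← mul_mean_eq_one hcrit τ]
    refine le_mul_of_one_le_right' ?_
    rw [hm]; exact le_self_add
  obtain ⟨τ, k, hk, hμ⟩ := exists_two_le_offspring hnd hcrit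
  have h2 := h1 τ
  rw [hm] at h2
  have h3 : ∑' k : ℕ, ((k - 1 : ℕ) : ℝ≥0∞) * μ τ k = 0 := by
    have : 1 + ∑' k : ℕ, ((k - 1 : ℕ) : ℝ≥0∞) * μ τ k ≤ 1 + 0 := by simpa using h2
    simpa using (ENNReal.add_le_add_iff_left ENNReal.one_ne_top).1 this
  rw [ENNReal.tsum_eq_zero] at h3
  have := h3 k
  rw [mul_eq_zero, or_iff_left hμ, Nat.cast_eq_zero] at this
  omega

end Support

/-- With positive probability, the exploration goes from the stack `st` to the stack `st'`. -/
def Leads (μ : ZMod 2 → PMF ℕ) (j : ZMod 2) (st st' : List (ZMod 2)) : Prop :=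
  ∃ d : ℕ, ∃ c : ℝ≥0∞, c ≠ 0 ∧
    ∀ r n, c * sizeProb μ j (st' ++ r) n ≤ sizeProb μ j (st ++ r) (n + d)

namespace Leads

variable {j τ : ZMod 2} {st st' st'' : List (ZMod 2)}

lemma refl (st : List (ZMod 2)) : Leads μ j st st := ⟨0, 1, by simp, by simp⟩

lemma trans (h : Leads μ j st st') (h' : Leads μ j st' st'') : Leads μ j st st'' := by
  obtain ⟨d, c, hc, h⟩ := h
  obtain ⟨d', c', hc', h'⟩ := h'
  refine ⟨d' + d, c * c', mul_ne_zero hc hc', fun r n => ?_⟩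
  rw [mul_assoc, ← add_assoc]
  exact (mul_le_mul_right (h' r n) c).trans (h r _)

lemma append (h : Leads μ j st st') (r : List (ZMod 2)) : Leads μ j (st ++ r) (st' ++ r) := by
  obtain ⟨d, c, hc, h⟩ := h
  refine ⟨d, c, hc, fun r' n => ?_⟩
  simpa using h (r ++ r') n

lemma step {c : ℕ} (hc : μ τ c ≠ 0) : Leads μ j [τ] (List.replicate c (τ + 1)) :=
  ⟨if τ = j then 1 else 0, μ τ c, hc, fun r n => mul_sizeProb_le_sizeProb_cons j τ r c n⟩

lemma replicate_nil (h : Leads μ j [τ] []) (k : ℕ) : Leads μ j (List.replicate k τ) [] := by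
  induction k with
  | zero => exact refl _
  | succ k ih => exact (h.append (List.replicate k τ)).trans ih

lemma singleton_nil (hnd : Nondegenerate μ) (hcrit : Critical μ) (τ : ZMod 2) :
    Leads μ j [τ] [] := by
  obtain ⟨σ, hσ⟩ := exists_zero_offspring hnd hcrit
  have h : Leads μ j [σ] [] := step hσ
  by_cases hτ : τ = σ
  · rwa [hτ]
  obtain ⟨k, -, hk⟩ := exists_pos_offspring hcrit τ
  refine (step hk).trans ?_
  rw [← ne_eq, zmod_two_ne_iff] at hτ
  rw [hτ, zmod_two_add_one_add_one]
  exact h.replicate_nil k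

lemma replicate_succ (hnd : Nondegenerate μ) (hcrit : Critical μ) (τ : ZMod 2) (k : ℕ) :
    Leads μ j (List.replicate (k + 1) τ) [τ] := by
  rw [List.replicate_succ']
  exact ((singleton_nil hnd hcrit τ).replicate_nil k).append [τ]

/-- A vertex of type `j` may have a descendant of type `j` on the left of another one. -/
lemma exists_branching (hnd : Nondegenerate μ) (hcrit : Critical μ) (j : ZMod 2) :
    ∃ mid, Leads μ j [j] (j :: mid) ∧ Leads μ j mid [j] := by
  have hjj := zmod_two_add_one_add_one j
  obtain ⟨τ, q, hq, hμq⟩ := exists_two_le_offspring hnd hcrit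
  obtain ⟨q, rfl⟩ := Nat.exists_eq_add_of_le' hq
  obtain ⟨k, hk, hμk⟩ := exists_pos_offspring hcrit (τ + 1)
  obtain ⟨k, rfl⟩ := Nat.exists_eq_add_of_le' hk
  by_cases hτ : τ = j
  · subst hτ
    have s1 : Leads μ τ [τ] (List.replicate (q + 2) (τ + 1)) := step hμq
    have s2 : Leads μ τ [τ + 1] (List.replicate (k + 1) τ) := by simpa only [hjj] using step hμk
    refine ⟨List.replicate k τ ++ List.replicate (q + 1) (τ + 1), s1.trans ?_, ?_⟩
    · exact s2.append (List.replicate (q + 1) (τ + 1))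
    · exact (((singleton_nil hnd hcrit τ).replicate_nil k).append _).trans
        ((replicate_succ hnd hcrit _ q).trans (s2.trans (replicate_succ hnd hcrit _ k)))
  · rw [← ne_eq, zmod_two_ne_iff] at hτ
    subst hτ
    rw [hjj] at hμk
    have s1 : Leads μ j [j] (List.replicate (k + 1) (j + 1)) := step hμk
    have s2 : Leads μ j [j + 1] (List.replicate (q + 2) j) := by simpa only [hjj] using step hμq
    exact ⟨List.replicate (q + 1) j, s1.trans ((replicate_succ hnd hcrit _ k).trans s2),
      replicate_succ hnd hcrit _ q⟩

end Leads

/-- Grafting a tree with `m` vertices of type `j` next to a vertex of type `j`. -/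
lemma exists_graft_cons (hnd : Nondegenerate μ) (hcrit : Critical μ) (j : ZMod 2) :
    ∃ d : ℕ, ∃ c : ℝ≥0∞, c ≠ 0 ∧ ∀ r n m,
      c * sizeProb μ j [j] m * sizeProb μ j (j :: r) n ≤ sizeProb μ j (j :: r) (n + (m + d)) := by
  obtain ⟨mid, ⟨d, c, hc, h⟩, ⟨d', c', hc', h'⟩⟩ := Leads.exists_branching hnd hcrit j
  refine ⟨d + d', c * c', mul_ne_zero hc hc', fun r n m => ?_⟩
  calc c * c' * sizeProb μ j [j] m * sizeProb μ j (j :: r) n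
      = c * (sizeProb μ j [j] m * (c' * sizeProb μ j ([j] ++ r) n)) := by
        rw [List.singleton_append]; ring
    _ ≤ c * (sizeProb μ j [j] m * sizeProb μ j (mid ++ r) (n + d')) := by
        gcongr; exact h' r n
    _ ≤ c * sizeProb μ j (j :: mid ++ r) (m + (n + d')) := by
        gcongr; exact sizeProb_mul_le j [j] _ m _
    _ ≤ sizeProb μ j ([j] ++ r) (m + (n + d') + d) := h r _
    _ = _ := by
        rw [List.singleton_append]; congr 1; ring

lemma exists_graft (hnd : Nondegenerate μ) (hcrit : Critical μ) (i j : ZMod 2) :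
    ∃ d : ℕ, ∃ c : ℝ≥0∞, c ≠ 0 ∧ ∀ n m, 1 ≤ n →
      c * sizeProb μ j [j] m * sizeProb μ j [i] n ≤ sizeProb μ j [i] (n + (m + d)) := by
  obtain ⟨d, c, hc, h⟩ := exists_graft_cons hnd hcrit j
  refine ⟨d, c, hc, fun n m hn => ?_⟩
  by_cases hij : i = j
  · subst hij; exact h [] n m
  rw [sizeProb_singleton_eq_tsum hij, sizeProb_singleton_eq_tsum hij, ← ENNReal.tsum_mul_left]
  refine ENNReal.tsum_le_tsum fun k => ?_
  rw [mul_left_comm]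
  refine mul_le_mul_right ?_ _
  -- A childless root of type other than `j` gives no vertex of type `j` to graft at; `1 ≤ n` rules
  -- this out.
  cases k with
  | zero => simp [sizeProb_nil, Nat.one_le_iff_ne_zero.1 hn]
  | succ k => exact h _ n m

/-! ### Divergence of the generating function beyond `1`. -/

section GeneratingFunction

/-- The generating function of the number of vertices of type `j`. -/
noncomputable def genFun (μ : ZMod 2 → PMF ℕ) (j : ZMod 2) (z : ℝ≥0∞) (st : List (ZMod 2)) :
    ℝ≥0∞ :=
  total μ st fun w => z ^ (typeSeq st w).count j

lemma genFun_mul_le (j : ZMod 2) (z : ℝ≥0∞) (st st' : List (ZMod 2)) :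
    genFun μ j z st * genFun μ j z st' ≤ genFun μ j z (st ++ st') := by
  refine le_trans ?_ (total_mul_le _ _ _)
  rw [genFun, total, ← ENNReal.tsum_mul_right]
  refine ENNReal.tsum_le_tsum fun w => ?_
  by_cases hw : weight μ st w = 0
  · simp [hw]
  rw [mul_assoc]
  refine mul_le_mul_right ?_ _
  simp_rw [typeSeq_append hw, List.count_append, pow_add]
  rw [genFun, total, total, ← ENNReal.tsum_mul_left]
  exact le_of_eq (tsum_congr fun w' => mul_left_comm _ _ _)

lemma genFun_pow_le (j : ZMod 2) (z : ℝ≥0∞) (τ : ZMod 2) (k : ℕ) :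
    genFun μ j z [τ] ^ k ≤ genFun μ j z (List.replicate k τ) := by
  induction k with
  | zero => simp [genFun]
  | succ k ih =>
    rw [pow_succ']
    exact (mul_le_mul_right ih _).trans (genFun_mul_le j z [τ] _)

/-- The branching equation at the root. Only this inequality is needed, since `genFun` is to be
bounded from below. -/
lemma le_genFun_singleton (j : ZMod 2) (z : ℝ≥0∞) (τ : ZMod 2) :
    (if τ = j then z else 1) * ∑' k, μ τ k * genFun μ j z [τ + 1] ^ k ≤ genFun μ j z [τ] := by
  rw [genFun.eq_def μ j z [τ], total_cons, ← ENNReal.tsum_mul_left]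
  refine ENNReal.tsum_le_tsum fun k => ?_
  rw [mul_left_comm]
  refine mul_le_mul_right ((mul_le_mul_right (genFun_pow_le j z _ k) _).trans (le_of_eq ?_)) _
  rw [genFun, total, total, List.append_nil, ← ENNReal.tsum_mul_left]
  refine tsum_congr fun w => ?_
  rw [mul_left_comm, typeSeq_cons_cons, List.count_cons, pow_add, List.append_nil]
  by_cases h : τ = j <;> simp [h, mul_comm]

/-- Bernoulli's inequality `1 + k (x - 1) ≤ x ^ k`, with the subtraction moved across. -/
lemma one_add_mul_le_pow_add (x : ℝ≥0∞) (k : ℕ) : 1 + k * x ≤ x ^ k + k := by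
  rcases eq_or_ne x ∞ with rfl | hx
  · rcases k with _ | k
    · simp
    · simp
  lift x to NNReal using hx
  norm_cast
  rw [← NNReal.coe_le_coe]
  push_cast
  have := one_add_mul_le_pow (a := (x : ℝ) - 1) (by linarith [x.2]) k
  simp only [add_sub_cancel] at this
  linarith

lemma one_add_mean_mul_le (ν : PMF ℕ) (x : ℝ≥0∞) :
    1 + mean ν * x ≤ ∑' k, ν k * x ^ k + mean ν := by
  rw [mean, ← ENNReal.tsum_mul_right, ← ENNReal.tsum_add]
  nth_rewrite 1 [← ν.tsum_coe]
  rw [← ENNReal.tsum_add]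
  refine ENNReal.tsum_le_tsum fun k => ?_
  calc _ = ν k * (1 + k * x) := by ring
    _ ≤ ν k * (x ^ k + k) := mul_le_mul_right (one_add_mul_le_pow_add x k) _
    _ = _ := by ring

lemma sizeProb_le_genFun (j : ZMod 2) {z : ℝ≥0∞} (hz : 1 ≤ z) (st : List (ZMod 2)) (n : ℕ) :
    sizeProb μ j st n ≤ genFun μ j z st := by
  refine total_mono _ fun w => ?_
  split_ifs
  · exact one_le_pow₀ hz
  · exact zero_le

lemma genFun_ne_zero (hnd : Nondegenerate μ) (hcrit : Critical μ) (j : ZMod 2) {z : ℝ≥0∞}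
    (hz : 1 ≤ z) (τ : ZMod 2) : genFun μ j z [τ] ≠ 0 := by
  obtain ⟨d, c, hc, h⟩ := Leads.singleton_nil (j := j) hnd hcrit τ
  have h1 := (h [] 0).trans (sizeProb_le_genFun j hz _ _)
  simp only [List.append_nil, sizeProb_nil, if_true, mul_one] at h1
  exact ne_of_gt ((pos_iff_ne_zero.2 hc).trans_le h1)

/-- By criticality, the radius of convergence of the generating function is `1`. -/
lemma genFun_eq_top (hnd : Nondegenerate μ) (hcrit : Critical μ) (hm : ∀ τ, mean (μ τ) ≠ ∞)
    (j : ZMod 2) {z : ℝ≥0∞} (hz : 1 < z) : genFun μ j z [j] = ∞ := by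
  by_contra hx
  have hx0 := genFun_ne_zero hnd hcrit j hz.le j
  have h1 := le_genFun_singleton (μ := μ) j z j
  have h2 := le_genFun_singleton (μ := μ) j z (j + 1)
  rw [if_pos rfl] at h1
  rw [if_neg (zmod_two_ne_add_one j).symm, one_mul, zmod_two_add_one_add_one] at h2
  set x := genFun μ j z [j]
  set y := genFun μ j z [j + 1]
  have hmm := mul_mean_eq_one hcrit j
  set m := mean (μ j)
  set m' := mean (μ (j + 1))
  -- In subtractive form: `y - 1 ≥ m' (x - 1)` and `∑ μ j k y^k - 1 ≥ m (y - 1)`. As `m m' = 1`,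
  -- these give `x ≥ z x`, which is absurd for `0 < x < ∞`.
  have h3 : 1 + m' * x ≤ y + m' :=
    (one_add_mean_mul_le (μ (j + 1)) x).trans (by gcongr)
  have h4 : m + x ≤ m * y + 1 := by
    calc m + x = m * (1 + m' * x) := by rw [mul_add, mul_one, ← mul_assoc, hmm, one_mul]
      _ ≤ m * (y + m') := by gcongr
      _ = m * y + 1 := by rw [mul_add, hmm]
  -- Finiteness is needed to cancel `z * m` below; `z = ∞` would already make `x` infinite.
  have hzm : z * m ≠ ∞ := by
    obtain ⟨k, -, hk⟩ := exists_pos_offspring hcrit j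
    refine ENNReal.mul_ne_top ?_ (hm j)
    rintro rfl
    refine hx (top_le_iff.1 (le_trans (le_of_eq ?_) h1))
    refine (ENNReal.top_mul ?_).symm
    rw [Ne, ENNReal.tsum_eq_zero, not_forall]
    exact ⟨k, mul_ne_zero hk (pow_ne_zero _ (genFun_ne_zero hnd hcrit j le_top _))⟩
  have h5 : z * m + z * x ≤ z * m + x := by
    calc z * m + z * x = z * (m + x) := (mul_add _ _ _).symm
      _ ≤ z * (m * y + 1) := by gcongr
      _ = z * (1 + m * y) := by rw [add_comm]
      _ ≤ z * (∑' k, μ j k * y ^ k + m) :=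
        mul_le_mul_right (one_add_mean_mul_le _ _) _
      _ = z * ∑' k, μ j k * y ^ k + z * m := mul_add _ _ _
      _ ≤ x + z * m := by gcongr
      _ = z * m + x := add_comm _ _
  have h6 : z * x ≤ 1 * x := by simpa using (ENNReal.add_le_add_iff_left hzm).1 h5
  exact absurd hz (not_lt.2 ((ENNReal.mul_le_mul_iff_left hx0 hx).1 h6))

lemma genFun_eq_tsum (j : ZMod 2) (z : ℝ≥0∞) (st : List (ZMod 2)) :
    genFun μ j z st = ∑' n, sizeProb μ j st n * z ^ n := by
  simp_rw [genFun, sizeProb, total, ← ENNReal.tsum_mul_right]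
  rw [ENNReal.tsum_comm]
  refine tsum_congr fun w => ?_
  rw [tsum_eq_single ((typeSeq st w).count j)]
  · simp
  · intro n hn; simp [hn.symm]

end GeneratingFunction

/-! ### Subexponential lower bounds on the support. -/

/-- If the bound failed for all `m`, the generating function at `ρ⁻¹` would be dominated by the
convergent series `C ∑ ρ^n`. -/
lemma exists_lt_sizeProb (hnd : Nondegenerate μ) (hcrit : Critical μ)
    (hm : ∀ τ, mean (μ τ) ≠ ∞) (j : ZMod 2) {ρ C : ℝ≥0∞} (hρ0 : ρ ≠ 0) (hρ : ρ < 1) (hC : C ≠ ∞) :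
    ∃ m, C * (ρ * ρ) ^ m < sizeProb μ j [j] m := by
  by_contra! h
  have h1 := genFun_eq_top hnd hcrit hm j (z := ρ⁻¹) (ENNReal.one_lt_inv.2 hρ)
  rw [genFun_eq_tsum] at h1
  refine ne_top_of_le_ne_top (ENNReal.mul_ne_top hC ?_) (?_ : _ ≤ C * ∑' n : ℕ, ρ ^ n) h1
  · rw [ENNReal.tsum_geometric, ENNReal.inv_ne_top]
    exact (tsub_pos_of_lt hρ).ne'
  · rw [← ENNReal.tsum_mul_left]
    refine ENNReal.tsum_le_tsum fun n => ?_
    refine (mul_le_mul_left (h n) _).trans (le_of_eq ?_)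
    rw [mul_assoc, ← mul_pow, mul_assoc, ENNReal.mul_inv_cancel hρ0 hρ.ne_top, mul_one]

/-- In each residue class modulo `M`, the bound is propagated from the least positive index where
`L` does not vanish; `C` is the minimum of the starting values. -/
lemma exists_mul_pow_le_of_mul_le {L : ℕ → ℝ≥0∞} {b : ℝ≥0∞} (hb : b ≤ 1) {M : ℕ} (hM : M ≠ 0)
    (h : ∀ n, 1 ≤ n → b ^ M * L n ≤ L (n + M)) :
    ∃ C : ℝ≥0∞, C ≠ 0 ∧ ∀ n, 1 ≤ n → L n ≠ 0 → C * b ^ n ≤ L n := by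
  classical
  have hiter (n k : ℕ) (hn : 1 ≤ n) : b ^ (M * k) * L n ≤ L (n + M * k) := by
    induction k with
    | zero => simp
    | succ k ih =>
      calc _ = b ^ M * (b ^ (M * k) * L n) := by ring
        _ ≤ b ^ M * L (n + M * k) := by gcongr
        _ ≤ L (n + M * k + M) := h _ (by omega)
        _ = _ := by rw [mul_add_one, add_assoc]
  let P (s n : ℕ) : Prop := 1 ≤ n ∧ L n ≠ 0 ∧ n % M = s
  -- The value `1` on classes that miss the support only keeps the minimum positive.
  let D (s : ℕ) : ℝ≥0∞ := if hs : ∃ n, P s n then L (Nat.find hs) else 1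
  have hD (s : ℕ) : D s ≠ 0 := by
    by_cases hs : ∃ n, P s n
    · simpa only [D, dif_pos hs] using (Nat.find_spec hs).2.1
    · simp [D, dif_neg hs]
  refine ⟨(Finset.range M).inf D, ?_, fun n hn hL => ?_⟩
  · rw [← pos_iff_ne_zero, Finset.lt_inf_iff (by simp)]
    exact fun s _ => pos_iff_ne_zero.2 (hD s)
  · have hs : ∃ n', P (n % M) n' := ⟨n, hn, hL, rfl⟩
    have hle : Nat.find hs ≤ n := Nat.find_min' hs ⟨hn, hL, rfl⟩
    have hspec := Nat.find_spec hs
    have hDs : D (n % M) = L (Nat.find hs) := by simp only [D, dif_pos hs]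
    obtain ⟨k, hk⟩ : M ∣ n - Nat.find hs := (Nat.modEq_iff_dvd' hle).1 hspec.2.2
    have hn' : n = Nat.find hs + M * k := by omega
    calc _ ≤ D (n % M) * b ^ n := by
          gcongr; exact Finset.inf_le (Finset.mem_range.2 (Nat.mod_lt _ (Nat.pos_of_ne_zero hM)))
      _ ≤ L (Nat.find hs) * b ^ (M * k) := by
          rw [hDs]; exact mul_le_mul_right (pow_le_pow_right_of_le_one' hb (by omega)) _
      _ ≤ L (Nat.find hs + M * k) := by rw [mul_comm]; exact hiter _ _ hspec.1
      _ = L n := by rw [← hn']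

/-- The probabilities that a tree has `n` vertices of type `j` decay subexponentially along the
values of `n` for which they are positive. -/
lemma exists_mul_pow_le_sizeProb (hnd : Nondegenerate μ) (hcrit : Critical μ)
    (hm : ∀ τ, mean (μ τ) ≠ ∞) (i j : ZMod 2) {ρ : ℝ≥0∞} (hρ0 : ρ ≠ 0) (hρ : ρ < 1) :
    ∃ C : ℝ≥0∞, C ≠ 0 ∧ ∀ n, 1 ≤ n → sizeProb μ j [i] n ≠ 0 →
      C * (ρ * ρ) ^ n ≤ sizeProb μ j [i] n := by
  obtain ⟨d, c, hc, h⟩ := exists_graft hnd hcrit i j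
  -- The term `c⁻¹` compensates the grafting constant; the term `1` excludes `m = 0`, as
  -- probabilities are at most `1`.
  obtain ⟨m, hlt⟩ := exists_lt_sizeProb hnd hcrit hm j hρ0 hρ (C := 1 + c⁻¹)
    (by simpa using hc)
  have hρρ : ρ * ρ ≤ 1 := mul_le_one' hρ.le hρ.le
  have hm0 : m ≠ 0 := by
    rintro rfl
    refine absurd hlt (not_lt.2 ((sizeProb_le_one _ _ _).trans ?_))
    simp
  refine exists_mul_pow_le_of_mul_le hρρ (M := m + d) (by omega) fun n hn =>
    le_trans ?_ (h n m hn)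
  gcongr
  have h1 : 1 ≤ c * (1 + c⁻¹) := by
    rcases eq_or_ne c ∞ with rfl | hct
    · simp
    · rw [mul_add, ENNReal.mul_inv_cancel hc hct]; exact le_add_self
  calc (ρ * ρ) ^ (m + d) ≤ 1 * (ρ * ρ) ^ m := by
        rw [one_mul]; exact pow_le_pow_right_of_le_one' hρρ (by omega)
    _ ≤ c * (1 + c⁻¹) * (ρ * ρ) ^ m := by gcongr
    _ ≤ c * sizeProb μ j [j] m := by rw [mul_assoc]; gcongr

end TwoTypeGW

/-! ### The coding of planar trees by words. -/

namespace TwoTypeGW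

/-- The first `c` children of the word `u`. -/
def childList (u : Word) (c : ℕ) : List Word := (List.range c).map fun k => u ++ [k.succPNat]

/-- The vertices, in depth-first order, of the forest with child counts `w` and with roots `st`. -/
def visit : List Word → List ℕ → List Word := explore childList

@[simp] lemma visit_nil (w : List ℕ) : visit [] w = [] := by simp [visit, explore]

@[simp] lemma visit_cons_nil (u : Word) (st : List Word) : visit (u :: st) [] = [] := by
  simp [visit, explore]

@[simp] lemma visit_cons_cons (u : Word) (st : List Word) (c : ℕ) (w : List ℕ) :
    visit (u :: st) (c :: w) = u :: visit (childList u c ++ st) w := by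
  simp [visit, explore]

/-- The word `w` is the list of child counts of a forest of `h` trees. -/
def IsCode : ℕ → List ℕ → Prop
  | 0, [] => True
  | 0, _ :: _ => False
  | _ + 1, [] => False
  | h + 1, c :: w => IsCode (c + h) w

@[simp] lemma length_childList (u : Word) (c : ℕ) : (childList u c).length = c := by
  simp [childList]

lemma mem_childList {u v : Word} {c : ℕ} :
    v ∈ childList u c ↔ ∃ k < c, v = u ++ [k.succPNat] := by
  simp [childList, eq_comm]

lemma isCode_of_weight_ne_zero {μ : ZMod 2 → PMF ℕ} {st : List (ZMod 2)} {w : List ℕ}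
    (h : weight μ st w ≠ 0) : IsCode st.length w := by
  induction w generalizing st with
  | nil => cases st <;> simp_all [weight, IsCode]
  | cons c w ih =>
    cases st with
    | nil => simp [weight] at h
    | cons τ st => simpa [IsCode] using ih (right_ne_zero_of_mul h)

/-- The type of the vertex `u` when the root has type `i`. -/
def vertexType (i : ZMod 2) (u : Word) : ZMod 2 := i + (u.length : ZMod 2)

lemma map_vertexType_childList (i : ZMod 2) (u : Word) (c : ℕ) :
    (childList u c).map (vertexType i) = List.replicate c (vertexType i u + 1) := by
  rw [List.eq_replicate_iff]
  refine ⟨by simp, ?_⟩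
  simp only [List.mem_map, mem_childList]
  rintro _ ⟨_, ⟨k, -, rfl⟩, rfl⟩
  simp [vertexType, add_assoc]

lemma typeSeq_map_vertexType (i : ZMod 2) (st : List Word) (w : List ℕ) :
    typeSeq (st.map (vertexType i)) w = (visit st w).map (vertexType i) := by
  induction w generalizing st with
  | nil => cases st <;> simp
  | cons c w ih =>
    cases st with
    | nil => simp
    | cons u st => simp [← ih, map_vertexType_childList]

lemma weight_map_vertexType (μ : ZMod 2 → PMF ℕ) (i : ZMod 2) (f : Word → ℕ) {st : List Word}
    {w : List ℕ} (hc : IsCode st.length w) (h : (visit st w).map f = w) :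
    weight μ (st.map (vertexType i)) w =
      ((visit st w).map fun u => μ (vertexType i u) (f u)).prod := by
  induction w generalizing st with
  | nil => cases st <;> simp_all [weight, IsCode]
  | cons c w ih =>
    cases st with
    | nil => simp [IsCode] at hc
    | cons u st =>
      simp only [visit_cons_cons, List.map_cons, List.cons.injEq] at h
      have := ih (st := childList u c ++ st) (by simpa [IsCode] using hc) h.2
      rw [List.map_append, map_vertexType_childList] at this
      simp [weight, this, h.1]

/-- The word `u` branches off on the left of the word `v`. -/
def LeftOf (u v : Word) : Prop := ∃ p a x b y, a < b ∧ u = p ++ a :: x ∧ v = p ++ b :: y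

namespace LeftOf

lemma append {u v : Word} (h : LeftOf u v) (x y : Word) : LeftOf (u ++ x) (v ++ y) := by
  obtain ⟨p, a, x', b, y', hab, rfl, rfl⟩ := h
  exact ⟨p, a, x' ++ x, b, y' ++ y, hab, by simp, by simp⟩

lemma lt {u v : Word} (h : LeftOf u v) : u < v := by
  obtain ⟨p, a, x, b, y, hab, rfl, rfl⟩ := h
  exact List.append_left_lt (List.cons_lt_cons_iff.2 (Or.inl hab))

lemma not_self_append (u x : Word) : ¬ LeftOf u (u ++ x) := by
  rintro ⟨p, a, x', b, y, hab, rfl, h⟩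
  simp only [List.append_assoc, List.append_cancel_left_eq, List.cons_append,
    List.cons.injEq] at h
  exact hab.ne h.1

end LeftOf

lemma lt_append_cons (u : Word) (a : ℕ+) (x : Word) : u < u ++ a :: x := by
  have : u ++ [] < u ++ a :: x := List.append_left_lt (List.nil_lt_cons _ _)
  simpa using this

/-- The invariant of the exploration: the subtrees above the stack entries are disjoint and
lexicographically ordered. -/
lemma pairwise_childList_append {u : Word} {st : List Word} (h : (u :: st).Pairwise LeftOf)
    (c : ℕ) : (childList u c ++ st).Pairwise LeftOf := by
  rw [List.pairwise_cons] at h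
  rw [List.pairwise_append]
  refine ⟨?_, h.2, ?_⟩
  · rw [childList, List.pairwise_map]
    refine List.pairwise_lt_range.imp fun {k l} hkl => ?_
    exact ⟨u, _, [], _, [], Nat.succPNat_lt_succPNat.2 hkl, rfl, rfl⟩
  · intro v hv v' hv'
    obtain ⟨k, -, rfl⟩ := mem_childList.1 hv
    simpa using (h.1 v' hv').append [k.succPNat] []

lemma lt_of_mem_childList_append {u v r : Word} {st : List Word}
    (h : (u :: st).Pairwise LeftOf) {c : ℕ} (hr : r ∈ childList u c ++ st) (hrv : r <+: v) :
    u < v := by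
  obtain ⟨x, rfl⟩ := hrv
  rcases List.mem_append.1 hr with hr | hr
  · obtain ⟨k, -, rfl⟩ := mem_childList.1 hr
    simpa using lt_append_cons u k.succPNat x
  · simpa using (((List.pairwise_cons.1 h).1 r hr).append [] x).lt

lemma exists_prefix_of_mem_visit {st : List Word} {w : List ℕ} {v : Word} (hv : v ∈ visit st w) :
    ∃ r ∈ st, r <+: v := by
  induction w generalizing st with
  | nil => cases st <;> simp at hv
  | cons c w ih =>
    cases st with
    | nil => simp at hv
    | cons u st =>
      rw [visit_cons_cons, List.mem_cons] at hv
      rcases hv with rfl | hv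
      · exact ⟨v, by simp, List.prefix_rfl⟩
      · obtain ⟨r, hr, hrv⟩ := ih hv
        rcases List.mem_append.1 hr with hr | hr
        · obtain ⟨k, -, rfl⟩ := mem_childList.1 hr
          exact ⟨u, by simp, (List.prefix_append _ _).trans hrv⟩
        · exact ⟨r, by simp [hr], hrv⟩

lemma pairwise_lt_visit {st : List Word} (h : st.Pairwise LeftOf) (w : List ℕ) :
    (visit st w).Pairwise (· < ·) := by
  induction w generalizing st with
  | nil => cases st <;> simp
  | cons c w ih =>
    cases st with
    | nil => simp
    | cons u st =>
      rw [visit_cons_cons, List.pairwise_cons]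
      refine ⟨fun v hv => ?_, ih (pairwise_childList_append h c)⟩
      obtain ⟨r, hr, hrv⟩ := exists_prefix_of_mem_visit hv
      exact lt_of_mem_childList_append h hr hrv

lemma subset_visit {st : List Word} {w : List ℕ} (h : IsCode st.length w) : st ⊆ visit st w := by
  induction w generalizing st with
  | nil => cases st <;> simp_all [IsCode]
  | cons c w ih =>
    cases st with
    | nil => simp
    | cons u st =>
      have := ih (st := childList u c ++ st) (by simpa [IsCode] using h)
      rw [visit_cons_cons]
      exact List.cons_subset_cons u (List.append_subset.1 this).2

/-- A word not initially on the stack is put there with its elder siblings when its parent is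
visited, and a code visits all that is stacked. For the stack `[[]]` this is the closure axiom of a
tree. -/
lemma mem_visit_of_append_mem_visit {st : List Word} {w : List ℕ} (h : IsCode st.length w)
    {u : Word} {i : ℕ+} (hu : u ++ [i] ∈ visit st w) :
    u ++ [i] ∈ st ∨ (u ∈ visit st w ∧ ∀ j ≤ i, u ++ [j] ∈ visit st w) := by
  induction w generalizing st with
  | nil => cases st <;> simp at hu
  | cons c w ih =>
    cases st with
    | nil => simp at hu
    | cons v st =>
      have h' : IsCode (childList v c ++ st).length w := by simpa [IsCode] using h
      rw [visit_cons_cons, List.mem_cons] at hu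
      rw [visit_cons_cons]
      rcases hu with hu | hu
      · simp [hu]
      rcases ih h' hu with hu | ⟨hu, hj⟩
      · rcases List.mem_append.1 hu with hu | hu
        · right
          obtain ⟨k, hk, hvk⟩ := mem_childList.1 hu
          obtain ⟨rfl, hik⟩ := List.append_inj' hvk rfl
          obtain rfl : i = k.succPNat := by simpa using hik
          refine ⟨by simp, fun j hj => List.mem_cons_of_mem _ (subset_visit h' ?_)⟩
          refine List.mem_append_left _ (mem_childList.2 ⟨j.natPred, ?_, by simp⟩)
          rw [← PNat.natPred_le_natPred, Nat.natPred_succPNat] at hj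
          omega
        · exact Or.inl (List.mem_cons_of_mem _ hu)
      · exact Or.inr ⟨List.mem_cons_of_mem _ hu, fun j hji => List.mem_cons_of_mem _ (hj j hji)⟩

/-- The visited list determines the number of children of `u`: a child of index beyond `c` could be
visited only if `u` were visited a second time, or if the child were already in `st`. -/
lemma le_of_visit_childList_eq {u : Word} {st : List Word} (hst : (u :: st).Pairwise LeftOf)
    {c c' : ℕ} {w w' : List ℕ} (h : IsCode (childList u c ++ st).length w)
    (h' : IsCode (childList u c' ++ st).length w')
    (he : visit (childList u c ++ st) w = visit (childList u c' ++ st) w') : c' ≤ c := by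
  by_contra! hlt
  have h1 : u ++ [c.succPNat] ∈ visit (childList u c ++ st) w := by
    rw [he]
    exact subset_visit h' (List.mem_append_left _ (mem_childList.2 ⟨c, hlt, rfl⟩))
  rcases mem_visit_of_append_mem_visit h h1 with h2 | ⟨h2, -⟩
  · rcases List.mem_append.1 h2 with h2 | h2
    · obtain ⟨k, hk, hek⟩ := mem_childList.1 h2
      have := Nat.succPNat_injective (by simpa using hek)
      omega
    · exact LeftOf.not_self_append _ _ ((List.pairwise_cons.1 hst).1 _ h2)
  · obtain ⟨r, hr, hru⟩ := exists_prefix_of_mem_visit h2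
    exact lt_irrefl _ (lt_of_mem_childList_append hst hr hru)

lemma visit_injective {st : List Word} (hst : st.Pairwise LeftOf) {w w' : List ℕ}
    (h : IsCode st.length w) (h' : IsCode st.length w') (he : visit st w = visit st w') :
    w = w' := by
  induction w generalizing st w' with
  | nil => cases st <;> cases w' <;> simp_all [IsCode]
  | cons c w ih =>
    cases st with
    | nil => simp [IsCode] at h
    | cons u st =>
      cases w' with
      | nil => simp [IsCode] at h'
      | cons c' w' =>
        simp only [visit_cons_cons, List.cons.injEq, true_and] at he
        have h1 : IsCode (childList u c ++ st).length w := by simpa [IsCode] using h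
        have h1' : IsCode (childList u c' ++ st).length w' := by simpa [IsCode] using h'
        obtain rfl := le_antisymm (le_of_visit_childList_eq hst h1' h1 he.symm)
          (le_of_visit_childList_eq hst h1 h1' he)
        rw [ih (pairwise_childList_append hst c) h1 h1' he]

namespace PlanarTree

variable (t : PlanarTree)

lemma append_mem_verts_iff (u : Word) (k : ℕ) :
    u ++ [k.succPNat] ∈ t.verts ↔ k < t.children u := by
  classical
  have hinj : Function.Injective fun k : ℕ => u ++ [k.succPNat] := fun k l h =>
    Nat.succPNat_injective (by simpa using h)
  constructor
  · intro h
    have hsub : (Finset.range (k + 1)).image (fun k : ℕ => u ++ [k.succPNat]) ⊆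
        t.verts.filter fun v => ∃ i : ℕ+, v = u ++ [i] := by
      intro v hv
      obtain ⟨l, hl, rfl⟩ := Finset.mem_image.1 hv
      refine Finset.mem_filter.2 ⟨(t.closed u _ h).2 _ ?_, _, rfl⟩
      exact Nat.succPNat_le_succPNat.2 (Nat.lt_succ_iff.1 (Finset.mem_range.1 hl))
    have := Finset.card_le_card hsub
    rw [Finset.card_image_of_injective _ hinj, Finset.card_range] at this
    rw [children, ← Nat.succ_le_iff]
    convert this
  · intro h
    by_contra hk
    have hsub : (t.verts.filter fun v => ∃ i : ℕ+, v = u ++ [i]) ⊆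
        (Finset.range k).image fun k : ℕ => u ++ [k.succPNat] := by
      intro v hv
      obtain ⟨hv, i, rfl⟩ := Finset.mem_filter.1 hv
      refine Finset.mem_image.2 ⟨i.natPred, Finset.mem_range.2 ?_, by simp⟩
      by_contra! hle
      refine hk ((t.closed u i hv).2 _ ?_)
      rwa [← PNat.natPred_le_natPred, Nat.natPred_succPNat]
    have := Finset.card_le_card hsub
    rw [Finset.card_image_of_injective _ hinj, Finset.card_range] at this
    rw [children] at h
    refine absurd h (not_lt.2 ?_)
    convert this

lemma mem_verts_of_append (u x : Word) (h : u ++ x ∈ t.verts) : u ∈ t.verts := by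
  induction x using List.reverseRecOn with
  | nil => simpa using h
  | append_singleton x a ih =>
    rw [← List.append_assoc] at h
    exact ih (t.closed _ _ h).1

lemma exists_visit_eq {st : List Word} (hst : st.Pairwise LeftOf) (ht : ∀ u ∈ st, u ∈ t.verts) :
    ∃ w, IsCode st.length w ∧ (∀ v, v ∈ visit st w ↔ v ∈ t.verts ∧ ∃ r ∈ st, r <+: v) ∧
      (visit st w).map t.children = w := by
  classical
  -- The induction is on the number of vertices still to be visited; replacing `u` by its children
  -- removes exactly `u`.
  induction hn : (t.verts.filter fun v => ∃ r ∈ st, r <+: v).card using Nat.strong_induction_on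
    generalizing st with
  | _ n ih =>
    subst hn
    cases st with
    | nil => exact ⟨[], by simp [IsCode]⟩
    | cons u st =>
      have hu : u ∈ t.verts := ht u (by simp)
      have hmem (v : Word) : (v ∈ t.verts ∧ ∃ r ∈ u :: st, r <+: v) ↔
          v = u ∨ (v ∈ t.verts ∧ ∃ r ∈ childList u (t.children u) ++ st, r <+: v) := by
        constructor
        · rintro ⟨hv, r, hr, x, rfl⟩
          rcases List.mem_cons.1 hr with rfl | hr
          · rcases x with _ | ⟨a, x⟩
            · simp
            · refine Or.inr ⟨hv, r ++ [a], List.mem_append_left _ ?_, x, by simp⟩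
              have ha : r ++ [a] ∈ t.verts := t.mem_verts_of_append _ x (by simpa using hv)
              refine mem_childList.2 ⟨a.natPred, ?_, by simp⟩
              rw [← append_mem_verts_iff]
              simpa using ha
          · exact Or.inr ⟨hv, r, List.mem_append_right _ hr, List.prefix_append _ _⟩
        · rintro (rfl | ⟨hv, r, hr, hrv⟩)
          · exact ⟨hu, v, by simp, List.prefix_rfl⟩
          · refine ⟨hv, ?_⟩
            rcases List.mem_append.1 hr with hr | hr
            · obtain ⟨k, -, rfl⟩ := mem_childList.1 hr
              exact ⟨u, by simp, (List.prefix_append _ _).trans hrv⟩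
            · exact ⟨r, by simp [hr], hrv⟩
      have hsub : ∀ v ∈ childList u (t.children u) ++ st, v ∈ t.verts := by
        intro v hv
        rcases List.mem_append.1 hv with hv | hv
        · obtain ⟨k, hk, rfl⟩ := mem_childList.1 hv
          exact (t.append_mem_verts_iff u k).2 hk
        · exact ht v (by simp [hv])
      have hlt : (t.verts.filter fun v => ∃ r ∈ childList u (t.children u) ++ st, r <+: v).card <
          (t.verts.filter fun v => ∃ r ∈ u :: st, r <+: v).card := by
        refine Finset.card_lt_card ((Finset.ssubset_iff_of_subset fun v hv => ?_).2 ⟨u, ?_, ?_⟩)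
        · rw [Finset.mem_filter] at hv ⊢
          exact (hmem v).2 (Or.inr hv)
        · exact Finset.mem_filter.2 ⟨hu, u, by simp, List.prefix_rfl⟩
        · rw [Finset.mem_filter]
          rintro ⟨-, r, hr, hru⟩
          exact lt_irrefl _ (lt_of_mem_childList_append hst hr hru)
      obtain ⟨w, hw, hvw, hcw⟩ := ih _ hlt (pairwise_childList_append hst _) hsub rfl
      refine ⟨t.children u :: w, by simpa [IsCode] using hw, fun v => ?_, by simp [hcw]⟩
      rw [hmem, visit_cons_cons, List.mem_cons, hvw]

/-- The child counts of the vertices in depth-first order. -/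
noncomputable def code : List ℕ := t.depthFirst.map t.children

lemma depthFirst_eq_of_mem_iff {l : List Word} (hl : l.Pairwise (· < ·))
    (h : ∀ v, v ∈ l ↔ v ∈ t.verts) : t.depthFirst = l := by
  refine List.SortedLT.eq_of_mem_iff (Finset.sortedLT_sort _) hl.sortedLT fun v => ?_
  rw [depthFirst, Finset.mem_sort, h]

lemma isCode_code_and_visit_code : IsCode 1 t.code ∧ visit [[]] t.code = t.depthFirst := by
  obtain ⟨w, hw, hv, hc⟩ := t.exists_visit_eq (st := [[]]) (by simp) (by simp [t.root_mem])
  have h : t.depthFirst = visit [[]] w :=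
    t.depthFirst_eq_of_mem_iff (pairwise_lt_visit (by simp) w) fun v => by simp [hv]
  have h2 : t.code = w := by rw [code, h, hc]
  rw [h2, h]
  exact ⟨hw, rfl⟩

lemma isCode_code : IsCode 1 t.code := t.isCode_code_and_visit_code.1

lemma visit_code : visit [[]] t.code = t.depthFirst := t.isCode_code_and_visit_code.2

lemma toFinset_depthFirst : t.depthFirst.toFinset = t.verts := Finset.sort_toFinset _ _

lemma nodup_depthFirst : t.depthFirst.Nodup := Finset.sort_nodup _ _

lemma code_injective : Function.Injective code := by
  intro t t' h
  ext1
  rw [← toFinset_depthFirst, ← toFinset_depthFirst, ← visit_code, ← visit_code, h]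

lemma exists_code_eq {w : List ℕ} (hw : IsCode 1 w) : ∃ t : PlanarTree, t.code = w := by
  let t : PlanarTree :=
    { verts := (visit [[]] w).toFinset
      root_mem := by simpa using subset_visit (st := [[]]) hw
      closed := fun u i hu => by
        rw [List.mem_toFinset] at hu
        have := mem_visit_of_append_mem_visit (st := [[]]) hw hu
        simpa using this }
  refine ⟨t, visit_injective (st := [[]]) (by simp) t.isCode_code hw ?_⟩
  rw [visit_code]
  exact t.depthFirst_eq_of_mem_iff (pairwise_lt_visit (by simp) w) fun v => by simp [t]

lemma typeSeq_code (i : ZMod 2) : typeSeq [i] t.code = t.depthFirst.map (vertexType i) := by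
  rw [← visit_code, ← typeSeq_map_vertexType]
  simp [vertexType]

lemma weight_code (μ : ZMod 2 → PMF ℕ) (i : ZMod 2) : weight μ [i] t.code = gwWeight μ i t := by
  have h := weight_map_vertexType μ i t.children (st := [[]]) t.isCode_code
    (by rw [visit_code, code])
  rw [visit_code, ← List.prod_toFinset _ t.nodup_depthFirst, toFinset_depthFirst] at h
  simpa [vertexType, gwWeight] using h

lemma countUpTo_eq (i c : ZMod 2) (k : ℕ) :
    t.countUpTo i c k = ((typeSeq [i] t.code).take (k + 1)).count c := by
  rw [typeSeq_code, ← List.map_take, countUpTo, List.count, List.countP_map,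
    List.countP_eq_length_filter, ← List.toFinset_card_of_nodup]
  · congr 1
    ext v
    have hv : v ∈ t.depthFirst.take (k + 1) → v ∈ t.verts := fun h => by
      rw [← toFinset_depthFirst, List.mem_toFinset]; exact List.mem_of_mem_take h
    simp only [ofType, Finset.mem_inter, Finset.mem_filter, List.mem_toFinset, List.mem_filter,
      Function.comp_apply, beq_iff_eq, vertexType]
    tauto
  · exact (t.nodup_depthFirst.sublist (List.take_sublist _ _)).filter _

lemma card_ofType (i c : ZMod 2) : (t.ofType i c).card = (typeSeq [i] t.code).count c := by
  rw [typeSeq_code, List.count, List.countP_map, List.countP_eq_length_filter,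
    ← List.toFinset_card_of_nodup (t.nodup_depthFirst.filter _), List.toFinset_filter,
    toFinset_depthFirst, ofType]
  simp [vertexType]

lemma length_typeSeq_code (i : ZMod 2) : (typeSeq [i] t.code).length = t.size := by
  rw [typeSeq_code, List.length_map, size, depthFirst, Finset.length_sort]

end PlanarTree

open Classical in
/-- The law of the Galton-Watson tree in terms of words. -/
lemma gwLaw_apply (μ : ZMod 2 → PMF ℕ) (i : ZMod 2) (S : Set PlanarTree) (F : List ℕ → ℝ≥0∞)
    (hF : ∀ t : PlanarTree, F t.code = if t ∈ S then 1 else 0) :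
    gwLaw μ i S = total μ [i] F := by
  rw [gwLaw, Measure.sum_apply _ (MeasurableSpace.measurableSet_top), total, ← PlanarTree.code_injective.tsum_eq]
  · refine tsum_congr fun t => ?_
    rw [hF, t.weight_code, Measure.smul_apply, Measure.dirac_apply' _ (MeasurableSpace.measurableSet_top)]
    simp [Set.indicator_apply]
  -- Words of nonzero weight are codes of trees, so the sum over trees misses nothing.
  · intro w hw
    exact PlanarTree.exists_code_eq (isCode_of_weight_ne_zero (left_ne_zero_of_mul hw))


/-! ### Deterministic estimates: from type frequencies to the uniform distance. -/

lemma sum_count_eq_length (l : List (ZMod 2)) (c : ZMod 2) :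
    l.count c + l.count (c + 1) = l.length := by
  induction l with
  | nil => simp
  | cons a l ih =>
    rw [List.count_cons, List.count_cons, List.length_cons, ← ih]
    by_cases h : a = c
    · subst h
      simp
      ring
    · rw [← ne_eq, zmod_two_ne_iff] at h
      subst h
      simp [(zmod_two_ne_add_one c).symm]
      ring

/-- If each type is not much more frequent than predicted from the frequency of the other type, then
both types have the predicted frequencies. -/
lemma abs_count_sub_le {l : List (ZMod 2)} {m : ZMod 2 → ℝ} {E : ℝ} (hm0 : ∀ τ, 0 < m τ)
    (hm : ∀ τ, m τ * m (τ + 1) = 1)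
    (h : ∀ τ, (l.count (τ + 1) : ℝ) ≤ m τ * l.count τ + E) (c : ZMod 2) :
    |(l.count c : ℝ) - (1 + m c)⁻¹ * l.length| ≤ E := by
  have h1 := h c
  have h2 := h (c + 1)
  rw [zmod_two_add_one_add_one] at h2
  have hl : (l.count c : ℝ) + l.count (c + 1) = l.length := by
    exact_mod_cast sum_count_eq_length l c
  have hc := hm0 c
  -- The bound for type `c + 1`, multiplied by `m c`, becomes the converse of `h1`.
  have h3 : m c * l.count c ≤ l.count (c + 1) + m c * E := by
    calc m c * l.count c ≤ m c * (m (c + 1) * l.count (c + 1) + E) := by gcongr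
      _ = m c * m (c + 1) * l.count (c + 1) + m c * E := by ring
      _ = _ := by rw [hm, one_mul]
  have hE : 0 ≤ (1 + m c) * E := by linarith
  have hE' : 0 ≤ E := nonneg_of_mul_nonneg_right hE (by linarith)
  have e : (l.count c : ℝ) - (1 + m c)⁻¹ * l.length =
      (1 + m c)⁻¹ * (m c * l.count c - l.count (c + 1)) := by
    rw [← hl]; field_simp; ring
  rw [e, abs_mul, abs_of_pos (by positivity), inv_mul_le_iff₀ (by positivity), abs_le]
  constructor <;> nlinarith

lemma abs_div_sub_div_le {J K N k a E : ℝ} (ha : 0 < a) (hN : 0 < N) (hk0 : 0 ≤ k) (hk : k ≤ N)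
    (hJ : |J - a * k| ≤ E) (hK : |K - a * N| ≤ E) (hE : E ≤ a * N / 2) :
    |J / K - k / N| ≤ 4 * E / (a * N) := by
  have hE0 : 0 ≤ E := (abs_nonneg _).trans hJ
  have hKl : a * N / 2 ≤ K := by linarith [(abs_le.1 hK).1]
  have hK0 : 0 < K := lt_of_lt_of_le (by positivity) hKl
  have e : J / K - k / N = ((J - a * k) * N - k * (K - a * N)) / (K * N) := by
    field_simp; ring
  have hnum : |(J - a * k) * N - k * (K - a * N)| ≤ 2 * E * N := by
    calc _ ≤ |(J - a * k) * N| + |k * (K - a * N)| := abs_sub _ _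
      _ = |J - a * k| * N + k * |K - a * N| := by
        rw [abs_mul, abs_mul, abs_of_pos hN, abs_of_nonneg hk0]
      _ ≤ E * N + N * E := by gcongr
      _ = _ := by ring
  rw [e, abs_div, abs_of_pos (mul_pos hK0 hN), div_le_div_iff₀ (by positivity) (by positivity)]
  calc _ ≤ 2 * E * N * (a * N) := by gcongr
    _ = 4 * E * (a * N / 2 * N) := by ring
    _ ≤ _ := by gcongr

lemma abs_floor_add_one_div_sub_le {N : ℕ} (hN : 1 ≤ N) {s : ℝ} (hs0 : 0 ≤ s) (hs1 : s ≤ 1) :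
    |((⌊((N : ℝ) - 1) * s⌋₊ + 1 : ℕ) : ℝ) / N - s| ≤ 1 / N := by
  have hN' : (1 : ℝ) ≤ N := by exact_mod_cast hN
  have h1 := Nat.floor_le (a := ((N : ℝ) - 1) * s) (mul_nonneg (by linarith) hs0)
  have h2 := Nat.lt_floor_add_one (((N : ℝ) - 1) * s)
  have e (x : ℝ) : x / N - s = (x - s * N) / N := by field_simp
  rw [e, abs_div, abs_of_pos (a := (N : ℝ)) (by linarith)]
  gcongr
  push_cast
  rw [abs_le]
  constructor <;> nlinarith

namespace PlanarTree

variable (t : PlanarTree)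

lemma distToIdentity_le {m : ZMod 2 → ℝ} (hm0 : ∀ τ, 0 < m τ) (hm : ∀ τ, m τ * m (τ + 1) = 1)
    {κ : ℝ} (i j c : ZMod 2) (hκ0 : 0 < κ) (hκ : κ ≤ (1 + m c)⁻¹ / 6)
    (hn : 1 ≤ κ * (t.ofType i j).card)
    (h : ∀ τ, ¬ Exceeds τ (m τ + κ) (κ * (t.ofType i j).card) [i] t.code) :
    t.distToIdentity i c ≤ (12 / (1 + m c)⁻¹ + 1) * κ := by
  set a := (1 + m c)⁻¹ with ha
  have ha0 : 0 < a := by have := hm0 c; positivity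
  set l := typeSeq [i] t.code with hl
  have hlen : l.length = t.size := t.length_typeSeq_code i
  have hnN : ((t.ofType i j).card : ℝ) ≤ t.size := by
    exact_mod_cast Finset.card_le_card (Finset.filter_subset _ _)
  have hκN : 1 ≤ κ * t.size := hn.trans (by gcongr)
  have hN0 : 0 < (t.size : ℝ) := by
    by_contra! h0
    nlinarith
  have hN1 : 1 ≤ t.size := by exact_mod_cast hN0
  have hcount (k : ℕ) (hk : k ≤ t.size) :
      -- The three errors are the drift `κ` per vertex, the level `κ #t^(j)`, and the root, which
      -- counts for at most `1 ≤ κ #t`.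
      |((l.take k).count c : ℝ) - a * k| ≤ 3 * κ * t.size := by
    have key := abs_count_sub_le (l := l.take k) (E := 3 * κ * t.size) hm0 hm (fun τ => ?_) c
    · rwa [List.length_take, hlen, min_eq_left hk] at key
    · have h1 := count_take_le_of_not_exceeds (h τ) k
      have h2 : (([i] : List (ZMod 2)).count (τ + 1) : ℝ) ≤ 1 := by
        exact_mod_cast List.count_le_length (l := [i])
      have h3 : ((l.take k).count τ : ℝ) ≤ t.size := by
        rw [← hlen]
        exact_mod_cast List.count_le_length.trans (List.length_take_le' _ _)
      have h4 : κ * (t.ofType i j).card ≤ κ * t.size := by gcongr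
      have h5 : κ * (l.take k).count τ ≤ κ * t.size := by gcongr
      linarith
  have hcard : ((t.ofType i c).card : ℝ) = (l.take t.size).count c := by
    rw [t.card_ofType, ← hlen, List.take_length]
  have : Nonempty (Set.Icc (0 : ℝ) 1) := ⟨⟨0, by simp⟩⟩
  refine ciSup_le ?_
  rintro ⟨s, hs0, hs1⟩
  rw [normalizedCount, countUpTo_eq, hcard]
  set k := ⌊((t.size : ℝ) - 1) * s⌋₊ + 1 with hk
  have hkN : k ≤ t.size := by
    have : ⌊((t.size : ℝ) - 1) * s⌋₊ ≤ t.size - 1 := by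
      refine Nat.floor_le_of_le ?_
      rw [Nat.cast_sub hN1, Nat.cast_one]
      have : (1 : ℝ) ≤ t.size := by exact_mod_cast hN1
      nlinarith
    omega
  -- The assumption `κ ≤ a / 6` makes the error `3 κ #t` at most half of `a #t`, which keeps the
  -- denominator away from `0`.
  have d1 := abs_div_sub_div_le ha0 hN0 (Nat.cast_nonneg k) (by exact_mod_cast hkN) (hcount k hkN)
    (hcount _ le_rfl) (by nlinarith)
  have d2 : |(k : ℝ) / t.size - s| ≤ 1 / t.size := abs_floor_add_one_div_sub_le hN1 hs0 hs1
  calc _ ≤ |((l.take k).count c : ℝ) / (l.take t.size).count c - k / t.size| +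
        |(k : ℝ) / t.size - s| := abs_sub_le _ _ _
    _ ≤ 4 * (3 * κ * t.size) / (a * t.size) + κ := by
        refine add_le_add d1 (d2.trans ?_)
        rwa [div_le_iff₀ hN0]
    _ = (12 / a + 1) * κ := by field_simp; ring

end PlanarTree

/-! ### Transfer to the law of the tree, and conclusion. -/

lemma gwLaw_typeCountEvent (μ : ZMod 2 → PMF ℕ) (i j : ZMod 2) (n : ℕ) :
    gwLaw μ i (typeCountEvent i j n) = sizeProb μ j [i] n := by
  classical
  refine gwLaw_apply μ i _ _ fun t => ?_
  simp [typeCountEvent, t.card_ofType]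

lemma gwLaw_exceeds_le {μ : ZMod 2 → PMF ℕ} (i τ : ZMod 2) {a θ : ℝ} (hθ : 0 ≤ θ)
    (h : ∑' k : ℕ, μ τ k * ENNReal.ofReal (Real.exp (θ * k)) ≤ ENNReal.ofReal (Real.exp (θ * a)))
    (x : ℝ) : gwLaw μ i {t | Exceeds τ a x [i] t.code} ≤ ENNReal.ofReal (Real.exp (-(θ * x))) := by
  classical
  rw [gwLaw_apply μ i _ (fun w => if Exceeds τ a x [i] w then 1 else 0) fun t => by simp]
  exact total_exceeds_le hθ h x [i]

end TwoTypeGW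

/-- Conditionally on `#T^(j) = n`, the normalized counting processes of both types converge in
probability to the identity, uniformly on `[0, 1]`, as `n → ∞` along the values for which the
conditioning event has positive probability. -/
theorem lemma9 (μ : ZMod 2 → PMF ℕ)
    (hnondeg : TwoTypeGW.Nondegenerate μ) (hcrit : TwoTypeGW.Critical μ)
    (hexp : ∀ k : ZMod 2, TwoTypeGW.HasSmallExpMoments (μ k))
    (i j c : ZMod 2) (ε : ℝ) (hε : 0 < ε) :
    Tendsto
      (fun n : ℕ =>
        (TwoTypeGW.gwLaw μ i)[{t | ε < t.distToIdentity i c} | TwoTypeGW.typeCountEvent i j n])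
      (atTop ⊓ 𝓟 {n : ℕ | 0 < TwoTypeGW.gwLaw μ i (TwoTypeGW.typeCountEvent i j n)})
      (𝓝 0) := by
  have hmt (τ : ZMod 2) := (hexp τ).mean_ne_top
  set m : ZMod 2 → ℝ := fun τ => (TwoTypeGW.mean (μ τ)).toReal with hm_def
  have hm (τ : ZMod 2) : m τ * m (τ + 1) = 1 := by
    rw [hm_def, ← ENNReal.toReal_mul, TwoTypeGW.mul_mean_eq_one hcrit, ENNReal.toReal_one]
  have hm0 (τ : ZMod 2) : 0 < m τ :=
    lt_of_le_of_ne ENNReal.toReal_nonneg fun h => by simpa [← h] using hm τ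
  set a := (1 + m c)⁻¹ with ha
  have ha0 : 0 < a := by have := hm0 c; positivity
  obtain ⟨κ, hκ0, hκa, hκε⟩ : ∃ κ : ℝ, 0 < κ ∧ κ ≤ a / 6 ∧ (12 / a + 1) * κ ≤ ε := by
    refine ⟨min (a / 6) (ε / (12 / a + 1)), by positivity, min_le_left _ _, ?_⟩
    calc _ ≤ (12 / a + 1) * (ε / (12 / a + 1)) := by gcongr; exact min_le_right _ _
      _ = ε := by field_simp
  choose θ hθ0 hθ using fun τ => (hexp τ).exists_tsum_exp_le hκ0
  obtain ⟨δ, hδ0, hδ⟩ : ∃ δ : ℝ, 0 < δ ∧ ∀ τ, δ ≤ θ τ :=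
    ⟨min (θ 0) (θ 1), lt_min (hθ0 0) (hθ0 1), fun τ => by
      fin_cases τ
      · exact min_le_left _ _
      · exact min_le_right _ _⟩
  -- The bad event costs at most `2 ρ^(3n)` and the conditioning event has probability at least `C
  -- ρ^(2n)`, so the thirds leave a factor `ρ^n`.
  set ρ := ENNReal.ofReal (Real.exp (-(δ * κ / 3))) with hρ_def
  have hρ0 : ρ ≠ 0 := by simp [hρ_def, Real.exp_pos]
  have hρ1 : ρ < 1 := by
    rw [hρ_def, ENNReal.ofReal_lt_one, Real.exp_lt_one_iff]
    have : 0 < δ * κ / 3 := by positivity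
    linarith
  obtain ⟨C, hC0, hC⟩ := TwoTypeGW.exists_mul_pow_le_sizeProb hnondeg hcrit hmt i j hρ0 hρ1
  have hbad (n : ℕ) (hn : 1 ≤ κ * n) :
      TwoTypeGW.gwLaw μ i (TwoTypeGW.typeCountEvent i j n ∩ {t | ε < t.distToIdentity i c}) ≤
        2 * (ρ * ρ * ρ) ^ n := by
    have hτ (τ : ZMod 2) : TwoTypeGW.gwLaw μ i
        {t | TwoTypeGW.Exceeds τ (m τ + κ) (κ * n) [i] t.code} ≤ (ρ * ρ * ρ) ^ n := by
      refine (TwoTypeGW.gwLaw_exceeds_le i τ (hθ0 τ).le (hθ τ) _).trans ?_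
      rw [hρ_def, ← ENNReal.ofReal_mul (Real.exp_nonneg _), ← ENNReal.ofReal_mul (by positivity),
        ← ENNReal.ofReal_pow (by positivity), ← Real.exp_add, ← Real.exp_add, ← Real.exp_nat_mul]
      refine ENNReal.ofReal_le_ofReal (Real.exp_le_exp.2 ?_)
      have : δ * (κ * n) ≤ θ τ * (κ * n) := by gcongr; exact hδ τ
      linarith
    rw [two_mul]
    refine le_trans (measure_mono ?_) ((measure_union_le _ _).trans (add_le_add (hτ 0) (hτ 1)))
    rintro t ⟨rfl, ht⟩
    by_contra hnot
    rw [Set.mem_union, not_or] at hnot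
    refine absurd ht (not_lt.2 ((t.distToIdentity_le hm0 hm i j c hκ0 hκa hn ?_).trans hκε))
    intro τ
    fin_cases τ
    · exact hnot.1
    · exact hnot.2
  have hlim : Tendsto (fun n : ℕ => 2 * C⁻¹ * ρ ^ n) atTop (𝓝 0) := by
    simpa using ENNReal.Tendsto.const_mul (ENNReal.tendsto_pow_atTop_nhds_zero_of_lt_one hρ1)
      (Or.inr (ENNReal.mul_ne_top ENNReal.ofNat_ne_top (ENNReal.inv_ne_top.2 hC0)))
  refine tendsto_of_tendsto_of_tendsto_of_le_of_le' tendsto_const_nhds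
    (hlim.mono_left inf_le_left) (Eventually.of_forall fun _ => zero_le) ?_
  rw [eventually_inf_principal]
  filter_upwards [eventually_ge_atTop (max 1 ⌈1 / κ⌉₊)] with n hn hpos
  have hn1 : 1 ≤ n := (le_max_left _ _).trans hn
  have hnκ : 1 ≤ κ * n := by
    have := Nat.ceil_le.1 ((le_max_right _ _).trans hn)
    rwa [div_le_iff₀' hκ0] at this
  rw [TwoTypeGW.gwLaw_typeCountEvent] at hpos
  have hpow : (ρ * ρ) ^ n ≠ 0 := pow_ne_zero _ (mul_ne_zero hρ0 hρ0)
  have hpow' : (ρ * ρ) ^ n ≠ ∞ := ENNReal.pow_ne_top (ENNReal.mul_ne_top hρ1.ne_top hρ1.ne_top)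
  rw [ProbabilityTheory.cond_apply MeasurableSpace.measurableSet_top,
    TwoTypeGW.gwLaw_typeCountEvent]
  calc _ ≤ (C * (ρ * ρ) ^ n)⁻¹ * (2 * (ρ * ρ * ρ) ^ n) :=
        mul_le_mul' (ENNReal.inv_le_inv.2 (hC n hn1 hpos.ne')) (hbad n hnκ)
    _ = 2 * C⁻¹ * ρ ^ n * (((ρ * ρ) ^ n)⁻¹ * (ρ * ρ) ^ n) := by
        rw [ENNReal.mul_inv (Or.inl hC0) (Or.inr hpow), mul_pow (ρ * ρ) ρ]
        ring
    _ = _ := by rw [ENNReal.inv_mul_cancel hpow hpow', mul_one]
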